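/- Let $K$ be a field. Rooted trees are finite and non-planar, and are considered up to isomorphism. A subtree of a rooted tree $x$ is a connected set of vertices of $x$, with the induced rooted tree structure (its root is its vertex closest to the root of $x$); it is non-trivial if it has at least one edge. The contraction $x/s$ of a subtree $s$ of $x$ is the rooted tree obtained from $x$ by collapsing $s$ to a single vertex. Let $\mathcal{T}'$ be the $K$-vector space with basis the isomorphism classes of rooted trees with at least one edge. For trees $t,t',x$ with at least one edge, let $\mathcal{N}(t,t',x)$ be the number of subtrees $s$ of $x$ isomorphic to $t$ such that $x/s$ is isomorphic to $t'$. For fixed $t,t'$ only finitely many $x$ satisfy $\mathcal N(t,t',x)\neq 0$, and the insertion law is the bilinear law $\vartriangleright$ on $\mathcal{T}'$ given on trees by $$t\vartriangleright t'=\sum_{x}\mathcal{N}(t,t',x)\,x .$$ Proposition. The insertion law $\vartriangleright$ is left pre-Lie: for all $a,b,c\in\mathcal{T}'$, $$(a\vartriangleright b)\vartriangleright c-a\vartriangleright(b\vartriangleright c)=(b\vartriangleright a)\vartriangleright c-b\vartriangleright(a\vartriangleright c).$$ -/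

import Mathlib

/-! Rooted trees are Mathlib's `RootedTree`s (the vertices with the ancestor order, the root being
the least element `⊥`). An isomorphism of rooted trees is an isomorphism of these orders. -/

namespace TreeInsertion

/-- Finite rooted trees with at least one edge, that is with at least two vertices. -/
structure EdgedTree where
  /-- the underlying rooted tree -/
  tree : RootedTree.{0}
  [fin : Finite tree]
  [nontriv : Nontrivial tree]

attribute [instance] EdgedTree.fin EdgedTree.nontriv

/-- Isomorphism of rooted trees. -/
instance EdgedTree.setoid : Setoid EdgedTree where
  r s t := Nonempty (s.tree ≃o t.tree)
  iseqv :=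
    ⟨fun _ => ⟨OrderIso.refl _⟩, fun ⟨e⟩ => ⟨e.symm⟩, fun ⟨e⟩ ⟨f⟩ => ⟨e.trans f⟩⟩

/-- Isomorphism classes of finite rooted trees with at least one edge: the basis of the space on
which the insertion law is defined. -/
def TreeClass : Type 1 := Quotient EdgedTree.setoid

/-- A set `S` of vertices of a rooted tree spans a subtree with at least one edge: it has a vertex
which is an ancestor of all the others (the root of the subtree), it contains every vertex on the
path between two of its vertices one of which is an ancestor of the other, and it has at least two
vertices. Equivalently, `S` is connected and has at least two vertices. -/
structure IsSubtree {X : RootedTree.{0}} (S : Set X) : Prop where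
  exists_root : ∃ r, IsLeast S r
  ordConnected : S.OrdConnected
  nontrivial : S.Nontrivial

/-- The equivalence relation which identifies all the elements of `S` with each other. -/
def collapse {X : RootedTree.{0}} (S : Set X) : Setoid X where
  r a b := a = b ∨ (a ∈ S ∧ b ∈ S)
  iseqv :=
    ⟨fun _ => Or.inl rfl, by rintro a b (h | h) <;> tauto, by
      rintro a b c (rfl | h) (rfl | h') <;> tauto⟩

/-- The contracted tree `X / S`: all the vertices of `S` are collapsed to a single one. -/
def Contraction {X : RootedTree.{0}} (S : Set X) : Type := Quotient (collapse S)

/-- The ancestor relation of `X / S` is the image of the ancestor relation of `X`. -/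
instance {X : RootedTree.{0}} (S : Set X) : LE (Contraction S) where
  le p q := ∃ a b : X,
    Quotient.mk (collapse S) a = p ∧ Quotient.mk (collapse S) b = q ∧ a ≤ b

/-- The subtrees `S` of `x` which are isomorphic to `t` and such that `x / S` is isomorphic
to `t'`. A subtree carries the ancestor order of `x`, restricted to its vertices. -/
def subtreeSet (t t' x : EdgedTree) : Set (Set x.tree) :=
  {S | IsSubtree S ∧ Nonempty (S ≃o t.tree) ∧ Nonempty (Contraction S ≃o t'.tree)}

theorem contraction_image {X Y : RootedTree.{0}} (e : X ≃o Y) (S : Set X) :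
    Nonempty (Contraction (e '' S) ≃o Contraction S) := by
  have key : ∀ a b : X, (collapse S).r a b ↔ (collapse (e '' S)).r (e a) (e b) := by
    intro a b
    change (a = b ∨ (a ∈ S ∧ b ∈ S)) ↔ (e a = e b ∨ (e a ∈ e '' S ∧ e b ∈ e '' S))
    simp
  let f : Contraction S ≃ Contraction (e '' S) := Quotient.congr e.toEquiv key
  have hf : ∀ a : X, f (Quotient.mk (collapse S) a) = Quotient.mk (collapse (e '' S)) (e a) :=
    fun a => rfl
  refine ⟨OrderIso.symm ⟨f, ?_⟩⟩
  intro p q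
  constructor
  · rintro ⟨a, b, ha, hb, hab⟩
    refine ⟨e.symm a, e.symm b, f.injective ?_, f.injective ?_, e.symm.monotone hab⟩
    · rw [hf, e.apply_symm_apply]; exact ha
    · rw [hf, e.apply_symm_apply]; exact hb
  · rintro ⟨a, b, rfl, rfl, hab⟩
    exact ⟨e a, e b, rfl, rfl, e.monotone hab⟩

theorem image_mem_subtreeSet {t t' x s s' y : EdgedTree} (et : t.tree ≃o s.tree)
    (et' : t'.tree ≃o s'.tree) (e : x.tree ≃o y.tree) {S : Set x.tree}
    (hS : S ∈ subtreeSet t t' x) : e '' S ∈ subtreeSet s s' y := by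
  obtain ⟨⟨⟨r, hr⟩, hc, hn⟩, ⟨f⟩, ⟨g⟩⟩ := hS
  refine ⟨⟨⟨e r, e.monotone.map_isLeast hr⟩, ?_, hn.image e.injective⟩, ?_, ?_⟩
  · exact Set.ordConnected_image (s := S) e
  · exact ⟨(⟨e.toEquiv.image S, by intro a b; exact e.le_iff_le⟩ : S ≃o e '' S).symm.trans
      (f.trans et)⟩
  · exact ⟨(contraction_image e S).some.trans (g.trans et')⟩

theorem ncard_subtreeSet_le {t t' x s s' y : EdgedTree} (et : t.tree ≃o s.tree)
    (et' : t'.tree ≃o s'.tree) (e : x.tree ≃o y.tree) :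
    (subtreeSet t t' x).ncard ≤ (subtreeSet s s' y).ncard :=
  Set.ncard_le_ncard_of_injOn (Set.image e) (fun _ hS => image_mem_subtreeSet et et' e hS)
    (Set.image_injective.2 e.injective).injOn (Set.toFinite _)

theorem ncard_subtreeSet_congr {t t' x s s' y : EdgedTree} (et : t.tree ≃o s.tree)
    (et' : t'.tree ≃o s'.tree) (e : x.tree ≃o y.tree) :
    (subtreeSet t t' x).ncard = (subtreeSet s s' y).ncard :=
  le_antisymm (ncard_subtreeSet_le et et' e) (ncard_subtreeSet_le et.symm et'.symm e.symm)

/-- `N t t' x` is the number of subtrees of `x` isomorphic to `t` whose contraction gives `t'`. -/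
noncomputable def N (t t' x : TreeClass) : ℕ :=
  Quotient.liftOn x
    (fun X => Quotient.liftOn₂ t t' (fun T T' => (subtreeSet T T' X).ncard)
      (fun _ _ _ _ ⟨e⟩ ⟨e'⟩ => ncard_subtreeSet_congr e e' (OrderIso.refl _)))
    (fun X Y ⟨e⟩ => by
      induction t using Quotient.inductionOn
      induction t' using Quotient.inductionOn
      exact ncard_subtreeSet_congr (OrderIso.refl _) (OrderIso.refl _) e)

theorem N_mk (T T' X : EdgedTree) :
    N (Quotient.mk _ T) (Quotient.mk _ T') (Quotient.mk _ X) = (subtreeSet T T' X).ncard := rfl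

theorem card_le_of_mem_subtreeSet {t t' x : EdgedTree} {S : Set x.tree}
    (hS : S ∈ subtreeSet t t' x) :
    Nat.card x.tree ≤ Nat.card t.tree + Nat.card t'.tree := by
  classical
  obtain ⟨_, ⟨f⟩, ⟨g⟩⟩ := hS
  rw [← Nat.card_sum]
  refine Nat.card_le_card_of_injective (β := t.tree ⊕ t'.tree)
    (fun a => if h : a ∈ S then Sum.inl (f ⟨a, h⟩)
      else Sum.inr (g (Quotient.mk (collapse S) a))) ?_
  intro a b hab
  by_cases ha : a ∈ S <;> by_cases hb : b ∈ S <;> simp only [ha, hb, dif_pos, dif_neg,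
    not_false_eq_true, Sum.inl.injEq, Sum.inr.injEq, reduceCtorEq] at hab
  · simpa using f.injective hab
  · rcases Quotient.exact (g.injective hab) with h | h
    · exact h
    · exact absurd h.1 ha

theorem finite_card_le (n : ℕ) :
    (Quotient.mk EdgedTree.setoid '' {x | Nat.card x.tree ≤ n}).Finite := by
  let code (T : EdgedTree) (k : ℕ) (r : Fin k → Fin k → Prop) : Prop :=
    ∃ e : T.tree ≃ Fin k, ∀ a b, r (e a) (e b) ↔ a ≤ b
  have hex : ∀ T : EdgedTree, ∃ r, code T (Nat.card T.tree) r := fun T =>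
    ⟨fun i j => (Finite.equivFin T.tree).symm i ≤ (Finite.equivFin T.tree).symm j,
      Finite.equivFin T.tree, by simp⟩
  let F : (Σ k : Fin (n + 1), (Fin k → Fin k → Prop)) → Set TreeClass := fun p =>
    {c | ∃ T : EdgedTree, Quotient.mk _ T = c ∧ code T p.1 p.2}
  refine Set.Finite.subset (s := ⋃ p, F p) (Set.finite_iUnion fun p => ?_) ?_
  · refine Set.Subsingleton.finite ?_
    rintro _ ⟨T, rfl, e, he⟩ _ ⟨T', rfl, e', he'⟩
    refine Quotient.sound ⟨⟨e.trans e'.symm, ?_⟩⟩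
    intro a b
    rw [← he, ← he']
    simp
  · rintro _ ⟨T, hT, rfl⟩
    obtain ⟨r, hr⟩ := hex T
    exact Set.mem_iUnion.2 ⟨⟨⟨Nat.card T.tree, Nat.lt_succ_of_le hT⟩, r⟩, T, rfl, hr⟩

theorem finite_support_N (t t' : TreeClass) : {x : TreeClass | N t t' x ≠ 0}.Finite := by
  induction t using Quotient.inductionOn with | _ T => ?_
  induction t' using Quotient.inductionOn with | _ T' => ?_
  refine (finite_card_le (Nat.card T.tree + Nat.card T'.tree)).subset ?_
  intro x hx
  induction x using Quotient.inductionOn with | _ X => ?_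
  obtain ⟨S, hS⟩ := Set.nonempty_of_ncard_ne_zero hx
  exact ⟨X, card_le_of_mem_subtreeSet hS, rfl⟩

/-- `t ▷ t' = ∑ x, N t t' x • x` for two trees, a finite sum. -/
noncomputable def insertTree (K : Type*) [Field K] (t t' : TreeClass) : TreeClass →₀ K :=
  Finsupp.ofSupportFinite (fun x => (N t t' x : K))
    ((finite_support_N t t').subset fun x hx h => hx (by simp [h]))

/-- The insertion law `▷`, extended bilinearly to the `K`-vector space with basis the
(isomorphism classes of) trees with at least one edge. -/
noncomputable def insertion (K : Type*) [Field K] :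
    (TreeClass →₀ K) →ₗ[K] (TreeClass →₀ K) →ₗ[K] (TreeClass →₀ K) :=
  Finsupp.linearCombination K fun t => Finsupp.linearCombination K fun t' => insertTree K t t'

/-- A bilinear law `m` on `E` is left pre-Lie:
`(x * y) * z - x * (y * z) = (y * x) * z - y * (x * z)`. -/
def IsLeftPreLie {K E : Type*} [Field K] [AddCommGroup E] [Module K E]
    (m : E →ₗ[K] E →ₗ[K] E) : Prop :=
  ∀ x y z : E, m (m x y) z - m x (m y z) = m (m y x) z - m y (m x z)

end TreeInsertion

/-! The coefficient of `X` in `(A ▷ B) ▷ C` counts pairs of nested subtrees `S ⊆ U` of `X` with `S ≅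
A`, `U / S ≅ B`, `X / U ≅ C` (`sum_N_mul_N_left`). In `A ▷ (B ▷ C)` it counts a subtree `S ≅ A`
together with a subtree `W ≅ B` of `X / S`. The preimage of `W` in `X` either contains `S`, which
gives the same nested pairs, or misses `S`, which gives a pair of disjoint subtrees contracted to
reach `C` (`ncard_subtreeSet_collapse`, `sum_N_mul_N_right`). The nested pairs cancel in the
associator, leaving minus the number of disjoint pairs, and exchanging the two members of a pair
swaps `A` and `B` (`ncard_isSeparated_comm`).

Contractions are handled through `IsCollapse`: a quotient map carrying the image order is determined
by its kernel up to isomorphism of the target, so iterated contractions are compared by comparing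
relations on the vertices of `X`. -/

namespace TreeInsertion

/-! ### Rooted trees spanned by sets of vertices -/

section Restrict

/-- The ancestors of a vertex form a chain, so a maximal element of a bounded set is comparable with
all its elements. -/
theorem exists_isGreatest {X : RootedTree.{0}} [Finite X] {T : Set X} (hT : T.Nonempty)
    (hb : BddAbove T) : ∃ m, IsGreatest T m := by
  obtain ⟨m, hm⟩ := T.toFinite.exists_maximal hT
  obtain ⟨x, hx⟩ := hb
  refine ⟨m, hm.prop, fun a ha => ?_⟩
  rcases (le_total_of_directed (hx ha) (hx hm.prop)).symm with h | h
  · exact h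
  · exact hm.le_of_ge ha h

variable {X : RootedTree.{0}} [Finite X] {R : Set X} {r : X}

theorem exists_isGreatest_subtype {T : Set R} (hT : T.Nonempty)
    (hb : BddAbove T) : ∃ m, IsGreatest T m := by
  obtain ⟨x, hx⟩ := hb
  obtain ⟨_, ⟨m, hm, rfl⟩, h⟩ := exists_isGreatest (hT.image Subtype.val)
    ⟨x.1, by rintro _ ⟨a, ha, rfl⟩; exact hx ha⟩
  exact ⟨m, hm, fun a ha => h ⟨a, ha, rfl⟩⟩

/-- A set of vertices of a finite rooted tree, with a least element, is a rooted tree. -/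
noncomputable def restrict (R : Set X) (r : X) (hr : IsLeast R r) : RootedTree.{0} :=
  have hinf (a b : R) : ∃ m, IsGreatest {c : R | c ≤ a ∧ c ≤ b} m :=
    exists_isGreatest_subtype ⟨⟨r, hr.1⟩, hr.2 a.2, hr.2 b.2⟩ ⟨a, fun _ h => h.1⟩
  have hpred (a : R) (ha : a.1 ≠ r) : ∃ m, IsGreatest {c : R | c < a} m :=
    exists_isGreatest_subtype ⟨⟨r, hr.1⟩, lt_of_le_of_ne (hr.2 a.2) (Ne.symm ha)⟩
      ⟨a, fun _ h => le_of_lt h⟩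
  letI : SemilatticeInf R :=
    { (inferInstance : PartialOrder R) with
      inf a b := (hinf a b).choose
      inf_le_left a b := (hinf a b).choose_spec.1.1
      inf_le_right a b := (hinf a b).choose_spec.1.2
      le_inf a b c h h' := (hinf b c).choose_spec.2 ⟨h, h'⟩ }
  letI : OrderBot R := { bot := ⟨r, hr.1⟩, bot_le := fun a => hr.2 a.2 }
  letI : PredOrder R :=
    -- The root is its own predecessor. Since `R` need not be connected, the predecessor of another
    -- vertex is its nearest ancestor in `R`, perhaps not its parent in `X`.
    { pred a := open Classical in if ha : a.1 = r then a else (hpred a ha).choose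
      pred_le a := by
        split_ifs with ha
        · exact le_rfl
        · exact le_of_lt (hpred a ha).choose_spec.1
      min_of_le_pred {a} h := by
        split_ifs at h with ha
        · intro b _
          change a.1 ≤ b.1
          rw [ha]
          exact hr.2 b.2
        · exact absurd (hpred a ha).choose_spec.1 (not_lt_of_ge h)
      le_pred_of_lt {a b} h := by
        split_ifs with hb
        · exact le_of_lt h
        · exact (hpred b hb).choose_spec.2 h }
  { α := R }

/-- The edged tree on a set of at least two vertices, with a least element. -/
noncomputable def restrictEdged (X : EdgedTree) (R : Set X.tree) (r : X.tree) (hr : IsLeast R r)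
    (hn : R.Nontrivial) : EdgedTree where
  tree := restrict R r hr
  fin := inferInstanceAs (Finite R)
  nontriv := hn.coe_sort

/-- The identity, from a set of vertices to the tree it spans. -/
def restrictEdgedIso (X : EdgedTree) (R : Set X.tree) (r : X.tree) (hr : IsLeast R r)
    (hn : R.Nontrivial) : R ≃o (restrictEdged X R r hr hn).tree :=
  ⟨Equiv.refl _, Iff.rfl⟩

end Restrict

/-! ### Quotient maps of ordered sets -/

section Collapse

/-- A surjection onto an ordered set whose order relation is the image of that of the source. -/
structure IsCollapse {X Y : Type*} [LE X] [LE Y] (f : X → Y) : Prop where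
  surjective : Function.Surjective f
  le_iff : ∀ p q, p ≤ q ↔ ∃ a b, f a = p ∧ f b = q ∧ a ≤ b

/-- `Y` is the quotient of `X` by the relation `r`, with the image of the order relation. -/
def Collapses {X : Type*} [LE X] (r : X → X → Prop) (Y : Type*) [LE Y] : Prop :=
  ∃ f : X → Y, IsCollapse f ∧ ∀ a b, f a = f b ↔ r a b

variable {X Y Z : Type*} [LE X] [LE Y] [LE Z]

theorem IsCollapse.comp {g : Y → Z} {f : X → Y} (hg : IsCollapse g) (hf : IsCollapse f) :
    IsCollapse (g ∘ f) where
  surjective := hg.surjective.comp hf.surjective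
  le_iff p q := by
    rw [hg.le_iff]
    constructor
    · rintro ⟨_, _, rfl, rfl, h⟩
      obtain ⟨a, b, rfl, rfl, hab⟩ := (hf.le_iff _ _).1 h
      exact ⟨a, b, rfl, rfl, hab⟩
    · rintro ⟨a, b, rfl, rfl, h⟩
      exact ⟨f a, f b, rfl, rfl, (hf.le_iff (f a) (f b)).2 ⟨a, b, rfl, rfl, h⟩⟩

theorem IsCollapse.of_orderIso (e : X ≃o Y) : IsCollapse e where
  surjective := e.surjective
  le_iff p q := by
    constructor
    · intro h
      exact ⟨e.symm p, e.symm q, by simp, by simp, by simpa using h⟩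
    · rintro ⟨a, b, rfl, rfl, h⟩
      simpa using h

theorem IsCollapse.nonempty_orderIso {g : X → Z} {f : X → Y} (hg : IsCollapse g)
    (hf : IsCollapse f) (h : ∀ a b, f a = f b ↔ g a = g b) : Nonempty (Y ≃o Z) := by
  have h1 : ∀ a, g (Function.surjInv hf.surjective (f a)) = g a := fun a =>
    (h _ _).1 (Function.surjInv_eq hf.surjective _)
  have h2 : ∀ a, f (Function.surjInv hg.surjective (g a)) = f a := fun a =>
    (h _ _).2 (Function.surjInv_eq hg.surjective _)
  refine ⟨⟨⟨fun y => g (Function.surjInv hf.surjective y),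
    fun z => f (Function.surjInv hg.surjective z), ?_, ?_⟩, ?_⟩⟩
  · intro y
    obtain ⟨a, rfl⟩ := hf.surjective y
    simp [h1, h2]
  · intro z
    obtain ⟨a, rfl⟩ := hg.surjective z
    simp [h1, h2]
  · intro y y'
    obtain ⟨a, rfl⟩ := hf.surjective y
    obtain ⟨b, rfl⟩ := hf.surjective y'
    simp only [Equiv.coe_fn_mk, h1, hf.le_iff, hg.le_iff, h]

/-- A kernel determines the target, so a single known collapse with kernel `r` decides which `Z` are
quotients by `r`. -/
theorem IsCollapse.collapses_iff {f : X → Y} (hf : IsCollapse f) {r : X → X → Prop}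
    (hr : ∀ a b, f a = f b ↔ r a b) : Collapses r Z ↔ Nonempty (Y ≃o Z) := by
  constructor
  · rintro ⟨g, hg, h⟩
    exact hg.nonempty_orderIso hf fun a b => (hr a b).trans (h a b).symm
  · rintro ⟨e⟩
    exact ⟨e ∘ f, (IsCollapse.of_orderIso e).comp hf, fun a b => by simp [hr]⟩

/-- The projection onto the contracted tree. -/
def toContraction {X : RootedTree.{0}} (S : Set X) (a : X) : Contraction S :=
  Quotient.mk (collapse S) a

theorem isCollapse_toContraction {X : RootedTree.{0}} (S : Set X) :
    IsCollapse (toContraction S) where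
  surjective := Quotient.mk_surjective
  le_iff _ _ := Iff.rfl

theorem toContraction_eq_iff {X : RootedTree.{0}} (S : Set X) (a b : X) :
    toContraction S a = toContraction S b ↔ a = b ∨ (a ∈ S ∧ b ∈ S) :=
  Quotient.eq (r := collapse S)

end Collapse

/-! ### Subtrees of a contraction and their preimages -/

section Quotient

variable {X Q : RootedTree.{0}} {S : Set X} {r : X} {f : X → Q}

/-- Both `a` and `r` are ancestors of `b`, hence comparable; `r ≤ a ≤ b` would put `a` in `S` by
convexity. -/
theorem root_le_of_le_mem (hS : S.OrdConnected) (hr : IsLeast S r) {a b : X} (hb : b ∈ S)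
    (hab : a ≤ b) (ha : a ∉ S) : a ≤ r := by
  rcases (le_total_of_directed hab (hr.2 hb)).symm with h | h
  · exact h
  · exact absurd (hS.out hr.1 hb ⟨h, hab⟩) ha

/-- The order on the collapse of a subtree with root `r`. -/
theorem IsCollapse.apply_le_apply_iff (hf : IsCollapse f)
    (hfS : ∀ a b, f a = f b ↔ a = b ∨ (a ∈ S ∧ b ∈ S)) (hS : S.OrdConnected) (hr : IsLeast S r)
    (a b : X) : f a ≤ f b ↔ a ≤ b ∨ (a ∈ S ∧ r ≤ b) := by
  rw [hf.le_iff]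
  constructor
  · rintro ⟨a', b', ha, hb, hab⟩
    rw [hfS] at ha hb
    by_cases haS : a ∈ S
    · right
      refine ⟨haS, ?_⟩
      have ha' : r ≤ a' := by
        rcases ha with rfl | ha
        · exact hr.2 haS
        · exact hr.2 ha.1
      rcases hb with rfl | hb
      · exact ha'.trans hab
      · exact hr.2 hb.2
    · left
      obtain rfl : a' = a := ha.resolve_right fun h => haS h.2
      rcases hb with rfl | hb
      · exact hab
      · exact (root_le_of_le_mem hS hr hb.1 hab haS).trans (hr.2 hb.2)
  · rintro (h | ⟨h, h'⟩)
    · exact ⟨a, b, rfl, rfl, h⟩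
    · exact ⟨r, b, (hfS _ _).2 (Or.inr ⟨hr.1, h⟩), rfl, h'⟩

theorem IsCollapse.monotone (hf : IsCollapse f) : Monotone f := fun a b h =>
  (hf.le_iff _ _).2 ⟨a, b, rfl, rfl, h⟩

theorem IsCollapse.exists_root_preimage (hf : IsCollapse f)
    (hfS : ∀ a b, f a = f b ↔ a = b ∨ (a ∈ S ∧ b ∈ S)) (hS : IsSubtree S) {W : Set Q}
    (h : ∃ w, IsLeast W w) : ∃ z, IsLeast (f ⁻¹' W) z := by
  obtain ⟨r, hr⟩ := hS.exists_root
  obtain ⟨w, hw, hw'⟩ := h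
  obtain ⟨a, rfl⟩ := hf.surjective w
  have key := hf.apply_le_apply_iff hfS hS.ordConnected hr
  by_cases ha : a ∈ S
  -- If the root of `W` is the collapsed vertex, the root of `S` takes its place.
  · refine ⟨r, ?_, fun b hb => ?_⟩
    · rwa [Set.mem_preimage, (hfS r a).2 (Or.inr ⟨hr.1, ha⟩)]
    · rcases (key _ _).1 (hw' hb) with h | h
      · exact (hr.2 ha).trans h
      · exact h.2
  · exact ⟨a, hw, fun b hb => ((key _ _).1 (hw' hb)).resolve_right fun h => ha h.1⟩

theorem IsCollapse.exists_root_of_preimage (hf : IsCollapse f) {W : Set Q}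
    (h : ∃ z, IsLeast (f ⁻¹' W) z) : ∃ w, IsLeast W w := by
  obtain ⟨z, hz⟩ := h
  have := hf.monotone.map_isLeast hz
  rw [Set.image_preimage_eq _ hf.surjective] at this
  exact ⟨_, this⟩

/-- Nontriviality of `W` has to be assumed: for `W` the collapsed vertex alone, the preimage is `S`,
which is a subtree. -/
theorem IsCollapse.isSubtree_iff_of_subset (hf : IsCollapse f)
    (hfS : ∀ a b, f a = f b ↔ a = b ∨ (a ∈ S ∧ b ∈ S)) (hS : IsSubtree S) {W : Set Q}
    (hSW : S ⊆ f ⁻¹' W) (hW : W.Nontrivial) : IsSubtree W ↔ IsSubtree (f ⁻¹' W) := by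
  constructor
  · intro h
    exact ⟨hf.exists_root_preimage hfS hS h.exists_root,
      h.ordConnected.preimage_mono hf.monotone, hS.nontrivial.mono hSW⟩
  · intro h
    refine ⟨hf.exists_root_of_preimage h.exists_root, ⟨?_⟩, hW⟩
    intro p hp q hq x hx
    obtain ⟨a, rfl⟩ := hf.surjective p
    obtain ⟨b, rfl⟩ := hf.surjective x
    obtain ⟨c, rfl⟩ := hf.surjective q
    obtain ⟨r, hr⟩ := hS.exists_root
    have key := hf.apply_le_apply_iff hfS hS.ordConnected hr
    obtain ⟨a', ha', hab⟩ : ∃ a' ∈ f ⁻¹' W, a' ≤ b := by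
      rcases (key _ _).1 hx.1 with h | h
      · exact ⟨a, hp, h⟩
      · exact ⟨r, hSW hr.1, h.2⟩
    rcases (key _ _).1 hx.2 with h' | h'
    · exact h.ordConnected.out ha' hq ⟨hab, h'⟩
    · exact hSW h'.1

theorem IsCollapse.isSubtree_iff_of_disjoint (hf : IsCollapse f)
    (hfS : ∀ a b, f a = f b ↔ a = b ∨ (a ∈ S ∧ b ∈ S)) (hS : IsSubtree S) {W : Set Q}
    (hSW : Disjoint S (f ⁻¹' W)) : IsSubtree W ↔ IsSubtree (f ⁻¹' W) := by
  rw [Set.disjoint_right] at hSW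
  constructor
  · intro h
    exact ⟨hf.exists_root_preimage hfS hS h.exists_root,
      h.ordConnected.preimage_mono hf.monotone, h.nontrivial.preimage hf.surjective⟩
  · intro h
    refine ⟨hf.exists_root_of_preimage h.exists_root, ⟨?_⟩, ?_⟩
    · intro p hp q hq x hx
      obtain ⟨a, rfl⟩ := hf.surjective p
      obtain ⟨b, rfl⟩ := hf.surjective x
      obtain ⟨c, rfl⟩ := hf.surjective q
      obtain ⟨r, hr⟩ := hS.exists_root
      have key := hf.apply_le_apply_iff hfS hS.ordConnected hr
      have hab : a ≤ b := ((key _ _).1 hx.1).resolve_right fun h => hSW hp h.1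
      rcases (key _ _).1 hx.2 with h' | h'
      · exact h.ordConnected.out hp hq ⟨hab, h'⟩
      -- A path of `W` through the collapsed vertex would give `a ≤ r ≤ c` in `X`, forcing `r` into
      -- the preimage of `W`.
      · exact absurd hr.1 (hSW (h.ordConnected.out hp hq
          ⟨root_le_of_le_mem hS.ordConnected hr h'.1 hab (hSW hp), h'.2⟩))
    · obtain ⟨a, ha, b, hb, hab⟩ := h.nontrivial
      exact ⟨f a, ha, f b, hb, fun h => ((hfS _ _).1 h).elim hab fun h => hSW ha h.1⟩

theorem IsCollapse.restrictPreimage (hf : IsCollapse f) (W : Set Q) :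
    IsCollapse (W.restrictPreimage f) where
  surjective := Set.restrictPreimage_surjective W hf.surjective
  le_iff p q := by
    constructor
    · intro h
      obtain ⟨a, b, ha, hb, hab⟩ := (hf.le_iff p.1 q.1).1 h
      exact ⟨⟨a, by simp [ha]⟩, ⟨b, by simp [hb]⟩, Subtype.ext ha, Subtype.ext hb, hab⟩
    · rintro ⟨a, b, rfl, rfl, h⟩
      exact hf.monotone h

theorem IsCollapse.nonempty_orderIso_iff (hf : IsCollapse f)
    (hfS : ∀ a b, f a = f b ↔ a = b ∨ (a ∈ S ∧ b ∈ S)) (W : Set Q) (B : RootedTree.{0}) :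
    Nonempty (W ≃o B) ↔
      Collapses (fun a b : f ⁻¹' W => a = b ∨ (a.1 ∈ S ∧ b.1 ∈ S)) B :=
  ((hf.restrictPreimage W).collapses_iff fun a b => by
    rw [Subtype.ext_iff, Subtype.ext_iff]
    exact hfS a b).symm

theorem IsCollapse.nonempty_orderIso_iff_of_disjoint (hf : IsCollapse f)
    (hfS : ∀ a b, f a = f b ↔ a = b ∨ (a ∈ S ∧ b ∈ S)) {W : Set Q}
    (hSW : Disjoint S (f ⁻¹' W)) (B : RootedTree.{0}) :
    Nonempty (W ≃o B) ↔ Nonempty (f ⁻¹' W ≃o B) := by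
  rw [hf.nonempty_orderIso_iff hfS]
  refine (IsCollapse.of_orderIso (OrderIso.refl (f ⁻¹' W))).collapses_iff fun a b => ?_
  have := Set.disjoint_right.1 hSW a.2
  simp [this]

theorem IsCollapse.nonempty_contraction_iff (hf : IsCollapse f)
    (hfS : ∀ a b, f a = f b ↔ a = b ∨ (a ∈ S ∧ b ∈ S)) (W : Set Q) (C : RootedTree.{0}) :
    Nonempty (Contraction W ≃o C) ↔
      Collapses (fun a b : X => a = b ∨ (a ∈ S ∧ b ∈ S) ∨ (a ∈ f ⁻¹' W ∧ b ∈ f ⁻¹' W)) C :=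
  (((isCollapse_toContraction W).comp hf).collapses_iff fun a b => by
    rw [Function.comp_apply, Function.comp_apply, toContraction_eq_iff, hfS, or_assoc]
    rfl).symm

theorem IsCollapse.nonempty_contraction_iff_of_subset (hf : IsCollapse f)
    (hfS : ∀ a b, f a = f b ↔ a = b ∨ (a ∈ S ∧ b ∈ S)) {W : Set Q} (hSW : S ⊆ f ⁻¹' W)
    (C : RootedTree.{0}) :
    Nonempty (Contraction W ≃o C) ↔ Nonempty (Contraction (f ⁻¹' W) ≃o C) := by
  rw [hf.nonempty_contraction_iff hfS]
  refine (isCollapse_toContraction (f ⁻¹' W)).collapses_iff fun a b => ?_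
  rw [toContraction_eq_iff]
  have ha := @hSW a
  have hb := @hSW b
  tauto

end Quotient

/-- A subtree which is not the whole tree can be contracted. -/
theorem IsSubtree.exists_isCollapse {X : EdgedTree} {S : Set X.tree} (hS : IsSubtree S)
    (hne : S ≠ Set.univ) : ∃ (Q : EdgedTree) (f : X.tree → Q.tree), IsCollapse f ∧
      ∀ a b, f a = f b ↔ a = b ∨ (a ∈ S ∧ b ∈ S) := by
  classical
  obtain ⟨r, hr⟩ := hS.exists_root
  -- The contraction is modelled on the vertices outside `S` together with `r`, which represents all
  -- of `S`.
  have hR : IsLeast {a : X.tree | a ∈ S → a = r} ⊥ :=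
    ⟨fun h => le_antisymm bot_le (hr.2 h), fun _ _ => bot_le⟩
  have hn : {a : X.tree | a ∈ S → a = r}.Nontrivial := by
    obtain ⟨b, hb⟩ := (Set.ne_univ_iff_exists_notMem S).1 hne
    exact ⟨b, fun h => absurd h hb, r, fun _ => rfl, fun h => hb (h ▸ hr.1)⟩
  let f : X.tree → {a : X.tree | a ∈ S → a = r} := fun a =>
    if h : a ∈ S then ⟨r, fun _ => rfl⟩ else ⟨a, fun h' => absurd h' h⟩
  have hmem : ∀ a, a ∈ S → (f a).1 = r := fun a h => by simp [f, h]
  have hnot : ∀ a, a ∉ S → (f a).1 = a := fun a h => by simp [f, h]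
  have hid : ∀ p : {a : X.tree | a ∈ S → a = r}, f p.1 = p := by
    intro p
    by_cases hp : p.1 ∈ S
    · exact Subtype.ext ((hmem _ hp).trans (p.2 hp).symm)
    · exact Subtype.ext (hnot _ hp)
  have hf : IsCollapse f := by
    refine ⟨fun p => ⟨p.1, hid p⟩, fun p q => ⟨fun h => ⟨p.1, q.1, hid p, hid q, h⟩, ?_⟩⟩
    rintro ⟨a, b, rfl, rfl, hab⟩
    change (f a).1 ≤ (f b).1
    by_cases ha : a ∈ S <;> by_cases hb : b ∈ S
    · rw [hmem a ha, hmem b hb]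
    · rw [hmem a ha, hnot b hb]
      exact (hr.2 ha).trans hab
    · rw [hnot a ha, hmem b hb]
      exact root_le_of_le_mem hS.ordConnected hr hb hab ha
    · rwa [hnot a ha, hnot b hb]
  refine ⟨restrictEdged X _ ⊥ hR hn, restrictEdgedIso X _ ⊥ hR hn ∘ f,
    (IsCollapse.of_orderIso _).comp hf, fun a b => ?_⟩
  rw [Function.comp_apply, Function.comp_apply, EmbeddingLike.apply_eq_iff_eq, Subtype.ext_iff]
  by_cases ha : a ∈ S <;> by_cases hb : b ∈ S
  · simp [hmem, ha, hb]
  · rw [hmem a ha, hnot b hb]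
    refine ⟨fun h => absurd (h ▸ hr.1) hb, ?_⟩
    rintro (rfl | h)
    · exact absurd ha hb
    · exact absurd h.2 hb
  · rw [hnot a ha, hmem b hb]
    refine ⟨fun h => absurd (h ▸ hr.1) ha, ?_⟩
    rintro (rfl | h)
    · exact absurd hb ha
    · exact absurd h.1 ha
  · rw [hnot a ha, hnot b hb]
    simp [ha]


/-! ### Counting nested and disjoint pairs of subtrees -/

section Counting

/-- The isomorphism class of a tree. -/
def treeClass (T : EdgedTree) : TreeClass := Quotient.mk _ T

theorem exists_treeClass_eq (t : TreeClass) : ∃ T, treeClass T = t := Quotient.exists_rep t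

/-- The subtree `U` of `X` contains a subtree `S` isomorphic to `A`, with `U / S` isomorphic to
`B` and `X / U` isomorphic to `C`. -/
structure IsNested (A B C X : EdgedTree) (S U : Set X.tree) : Prop where
  inner : IsSubtree S
  outer : IsSubtree U
  subset : S ⊆ U
  inner_iso : Nonempty (S ≃o A.tree)
  middle : Collapses (fun a b : U => a = b ∨ (a.1 ∈ S ∧ b.1 ∈ S)) B.tree
  contraction_iso : Nonempty (Contraction U ≃o C.tree)

/-- The disjoint subtrees `S` and `V` of `X` are isomorphic to `A` and `B`, and contracting both
of them gives `C`. -/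
structure IsSeparated (A B C X : EdgedTree) (S V : Set X.tree) : Prop where
  left : IsSubtree S
  right : IsSubtree V
  disjoint : Disjoint S V
  left_iso : Nonempty (S ≃o A.tree)
  right_iso : Nonempty (V ≃o B.tree)
  collapses : Collapses (fun a b : X.tree => a = b ∨ (a ∈ S ∧ b ∈ S) ∨ (a ∈ V ∧ b ∈ V)) C.tree

theorem IsSeparated.symm {A B C X : EdgedTree} {S V : Set X.tree}
    (h : IsSeparated A B C X S V) : IsSeparated B A C X V S where
  left := h.right
  right := h.left
  disjoint := h.disjoint.symm
  left_iso := h.right_iso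
  right_iso := h.left_iso
  collapses := by
    have := h.collapses
    simp only [or_comm (a := _ ∈ S ∧ _)] at this
    exact this

theorem ncard_isSeparated_comm (A B C X : EdgedTree) :
    {p : Set X.tree × Set X.tree | IsSeparated A B C X p.1 p.2}.ncard =
      {p : Set X.tree × Set X.tree | IsSeparated B A C X p.1 p.2}.ncard := by
  rw [← Set.ncard_image_of_injective _ Prod.swap_injective]
  congr 1
  ext ⟨S, V⟩
  simp only [Set.image_swap_eq_preimage_swap]
  exact ⟨IsSeparated.symm, IsSeparated.symm⟩

/-- The subtrees of the contraction of `S` come from the subtrees of `X` containing `S` and the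
subtrees of `X` disjoint from `S`. -/
theorem ncard_subtreeSet_collapse {A B C X Q : EdgedTree} {S : Set X.tree} {f : X.tree → Q.tree}
    (hS : IsSubtree S) (hA : Nonempty (S ≃o A.tree)) (hf : IsCollapse f)
    (hfS : ∀ a b, f a = f b ↔ a = b ∨ (a ∈ S ∧ b ∈ S)) :
    (subtreeSet B C Q).ncard =
      {Z | IsNested A B C X S Z ∨ IsSeparated A B C X S Z}.ncard := by
  rw [← Set.ncard_image_of_injective _ (Set.preimage_injective.2 hf.surjective)]
  congr 1
  have hnt : ∀ W : Set Q.tree, Nonempty (W ≃o B.tree) → W.Nontrivial := by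
    rintro W ⟨e⟩
    exact Set.nontrivial_coe_sort.1 e.toEquiv.nontrivial
  ext Z
  constructor
  · rintro ⟨W, ⟨hW, hB, hC⟩, rfl⟩
    by_cases hSW : S ⊆ f ⁻¹' W
    · exact Or.inl ⟨hS, (hf.isSubtree_iff_of_subset hfS hS hSW hW.nontrivial).1 hW, hSW, hA,
        (hf.nonempty_orderIso_iff hfS W _).1 hB,
        (hf.nonempty_contraction_iff_of_subset hfS hSW _).1 hC⟩
    · have hd : Disjoint S (f ⁻¹' W) := by
        rw [Set.disjoint_left]
        intro a ha haW
        refine hSW fun b hb => ?_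
        rwa [Set.mem_preimage, (hfS b a).2 (Or.inr ⟨hb, ha⟩)]
      exact Or.inr ⟨hS, (hf.isSubtree_iff_of_disjoint hfS hS hd).1 hW, hd, hA,
        (hf.nonempty_orderIso_iff_of_disjoint hfS hd _).1 hB,
        (hf.nonempty_contraction_iff hfS W _).1 hC⟩
  · intro h
    -- `Z` contains `S` or misses it, so it is a union of fibres of `f`.
    have hsat : f ⁻¹' (f '' Z) = Z := by
      refine (Set.subset_preimage_image f Z).antisymm' ?_
      rintro a ⟨b, hb, hab⟩
      rcases (hfS _ _).1 hab with rfl | ⟨h1, h2⟩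
      · exact hb
      · rcases h with h | h
        · exact h.subset h2
        · exact absurd hb (Set.disjoint_left.1 h.disjoint h1)
    refine ⟨f '' Z, ?_, hsat⟩
    generalize f '' Z = W at hsat
    subst hsat
    rcases h with h | h
    · have hB := (hf.nonempty_orderIso_iff hfS W _).2 h.middle
      exact ⟨(hf.isSubtree_iff_of_subset hfS hS h.subset (hnt W hB)).2 h.outer, hB,
        (hf.nonempty_contraction_iff_of_subset hfS h.subset _).2 h.contraction_iso⟩
    · exact ⟨(hf.isSubtree_iff_of_disjoint hfS hS h.disjoint).2 h.right,
        (hf.nonempty_orderIso_iff_of_disjoint hfS h.disjoint _).2 h.right_iso,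
        (hf.nonempty_contraction_iff hfS W _).2 h.collapses⟩

/-- The subtrees of a subtree `U` of `X` are the subtrees of `X` contained in `U`. -/
theorem ncard_subtreeSet_restrict {A B C X Y : EdgedTree} {U : Set X.tree} (hU : IsSubtree U)
    (e : U ≃o Y.tree) (hC : Nonempty (Contraction U ≃o C.tree)) :
    (subtreeSet A B Y).ncard = {S | IsNested A B C X S U}.ncard := by
  let g : Y.tree ↪o X.tree := e.symm.toOrderEmbedding.trans (OrderEmbedding.subtype (· ∈ U))
  have hgU : ∀ y, g y ∈ U := fun y => (e.symm y).2
  have hge : ∀ u : U, g (e u) = u.1 := fun u => by simp [g]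
  have hrange : Set.range g = U := by
    ext a
    exact ⟨by rintro ⟨y, rfl⟩; exact hgU y, fun h => ⟨e ⟨a, h⟩, hge _⟩⟩
  rw [← Set.ncard_image_of_injective _ (Set.image_injective.2 g.injective)]
  congr 1
  have hsub : ∀ T : Set Y.tree, IsSubtree T ↔ IsSubtree (g '' T) := by
    intro T
    constructor
    · rintro ⟨⟨r, hr⟩, hc, hn⟩
      refine ⟨⟨g r, g.monotone.map_isLeast hr⟩, ⟨?_⟩, hn.image g.injective⟩
      rintro _ ⟨a, ha, rfl⟩ _ ⟨b, hb, rfl⟩ x hx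
      -- Convexity of `U` keeps paths of `X` between its vertices inside `U`.
      have hxU : x ∈ Set.range g := hrange ▸ hU.ordConnected.out (hgU a) (hgU b) hx
      obtain ⟨y, rfl⟩ := hxU
      exact ⟨y, hc.out ha hb ⟨g.le_iff_le.1 hx.1, g.le_iff_le.1 hx.2⟩, rfl⟩
    · rintro ⟨⟨_, ⟨r, hr, rfl⟩, hr'⟩, hc, hn⟩
      refine ⟨⟨r, hr, fun b hb => g.le_iff_le.1 (hr' ⟨b, hb, rfl⟩)⟩, ?_, ?_⟩
      · have := hc.preimage_mono g.monotone
        rwa [Set.preimage_image_eq _ g.injective] at this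
      · exact (Set.image_nontrivial g.injective).1 hn
  have hiso : ∀ T : Set Y.tree, Nonempty (T ≃o A.tree) ↔ Nonempty (g '' T ≃o A.tree) := by
    intro T
    have i : T ≃o g '' T := ⟨Equiv.Set.image g T g.injective, g.le_iff_le⟩
    exact ⟨fun ⟨j⟩ => ⟨i.symm.trans j⟩, fun ⟨j⟩ => ⟨i.trans j⟩⟩
  have hcol : ∀ T : Set Y.tree, Nonempty (Contraction T ≃o B.tree) ↔
      Collapses (fun a b : U => a = b ∨ (a.1 ∈ g '' T ∧ b.1 ∈ g '' T)) B.tree := by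
    intro T
    have hmem : ∀ u : U, u.1 ∈ g '' T ↔ e u ∈ T := fun u => by
      rw [← hge u, g.injective.mem_set_image]
    refine (((isCollapse_toContraction T).comp (IsCollapse.of_orderIso e)).collapses_iff
      fun a b => ?_).symm
    rw [Function.comp_apply, Function.comp_apply, toContraction_eq_iff, hmem, hmem,
      EmbeddingLike.apply_eq_iff_eq]
  ext S
  constructor
  · rintro ⟨T, ⟨hT, hA, hB⟩, rfl⟩
    refine ⟨(hsub T).1 hT, hU, ?_, (hiso T).1 hA, (hcol T).1 hB, hC⟩
    rintro _ ⟨y, _, rfl⟩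
    exact hgU y
  · intro h
    obtain ⟨T, rfl⟩ : ∃ T, g '' T = S := Set.subset_range_iff_exists_image_eq.1 (hrange ▸ h.subset)
    exact ⟨T, ⟨(hsub T).2 h.inner, (hiso T).2 h.inner_iso, (hcol T).2 h.middle⟩, rfl⟩

/-- Counting pairs according to a label of their first component. -/
theorem sum_mul_ncard_fiber {α β γ : Type*} [Finite α] [Finite γ] (F : Finset β) (φ : β → ℕ)
    (hφ : ∀ y, φ y ≠ 0 → y ∈ F) (T : Set α) (g : α → β) (R : α → γ → Prop)
    (hR : ∀ a ∈ T, φ (g a) = {c | R a c}.ncard) (hT : ∀ a c, R a c → a ∈ T) :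
    ∑ y ∈ F, φ y * {a ∈ T | g a = y}.ncard = {p : α × γ | R p.1 p.2}.ncard := by
  classical
  have := Fintype.ofFinite α
  have := Fintype.ofFinite γ
  have h1 : {p : α × γ | R p.1 p.2}.ncard = ∑ a ∈ T.toFinset, {c | R a c}.ncard := by
    rw [Set.ncard_eq_toFinset_card', Finset.card_eq_sum_card_fiberwise (f := Prod.fst)
      (t := T.toFinset) (by rintro ⟨a, c⟩ h; simpa using hT a c (by simpa using h))]
    refine Finset.sum_congr rfl fun a _ => ?_
    rw [← Set.ncard_coe_finset, ← Set.ncard_image_of_injective {c | R a c} (Prod.mk_right_injective a)]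
    refine congrArg Set.ncard ?_
    ext ⟨a', c⟩
    simp only [Finset.coe_filter, Set.mem_toFinset, Set.mem_ofPred_eq, Set.mem_image,
      Prod.mk.injEq]
    constructor
    · rintro ⟨h, rfl⟩
      exact ⟨c, h, rfl, rfl⟩
    · rintro ⟨_, h, rfl, rfl⟩
      exact ⟨h, rfl⟩
  rw [h1, ← Finset.sum_congr rfl fun a ha => hR a (by simpa using ha)]
  have h2 : ∀ y, {a ∈ T | g a = y}.ncard = ∑ a ∈ T.toFinset, if g a = y then 1 else 0 := by
    intro y
    rw [← Finset.card_filter, ← Set.ncard_coe_finset]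
    congr 1
    ext a
    simp
  simp only [h2, Finset.mul_sum]
  rw [Finset.sum_comm]
  refine Finset.sum_congr rfl fun a _ => ?_
  simp only [mul_ite, mul_one, mul_zero, Finset.sum_ite_eq]
  -- A label outside `F` has `φ = 0`, so restricting the sum to `F` loses nothing.
  split_ifs with h
  · rfl
  · by_contra h'
    exact h (hφ _ (Ne.symm h'))

/-- The coefficient of `X` in `(A ▷ B) ▷ C`. -/
theorem sum_N_mul_N_left (A B C X : EdgedTree) (F : Finset TreeClass)
    (hF : ∀ y, N (treeClass A) (treeClass B) y ≠ 0 → y ∈ F) :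
    ∑ y ∈ F, N (treeClass A) (treeClass B) y * N y (treeClass C) (treeClass X) =
      {p : Set X.tree × Set X.tree | IsNested A B C X p.1 p.2}.ncard := by
  classical
  have hex : ∀ U : Set X.tree, ∃ Y : EdgedTree, IsSubtree U → Nonempty (U ≃o Y.tree) := by
    intro U
    by_cases hU : IsSubtree U
    · obtain ⟨r, hr⟩ := hU.exists_root
      exact ⟨_, fun _ => ⟨restrictEdgedIso X U r hr hU.nontrivial⟩⟩
    · exact ⟨X, fun h => absurd h hU⟩
  choose Y hY using hex
  -- The label is the class of the outer subtree `U`, which must come first.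
  rw [← Set.ncard_image_of_injective _ Prod.swap_injective, Set.image_swap_eq_preimage_swap]
  refine (Finset.sum_congr rfl fun y _ => ?_).trans (sum_mul_ncard_fiber F _ hF
    {U | IsSubtree U ∧ Nonempty (Contraction U ≃o C.tree)} (fun U => treeClass (Y U))
    (fun U S => IsNested A B C X S U) ?_ fun U S h => ⟨h.outer, h.contraction_iso⟩)
  · congr 1
    obtain ⟨Z, rfl⟩ := exists_treeClass_eq y
    refine (N_mk _ _ _).trans (congrArg Set.ncard ?_)
    ext U
    constructor
    · rintro ⟨hU, ⟨e⟩, hC⟩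
      obtain ⟨e'⟩ := hY U hU
      exact ⟨⟨hU, hC⟩, Quotient.sound ⟨e'.symm.trans e⟩⟩
    · rintro ⟨⟨hU, hC⟩, h⟩
      obtain ⟨e⟩ := Quotient.exact h
      obtain ⟨e'⟩ := hY U hU
      exact ⟨hU, ⟨e'.trans e⟩, hC⟩
  · rintro U ⟨hU, hC⟩
    obtain ⟨e⟩ := hY U hU
    exact (N_mk _ _ _).trans (ncard_subtreeSet_restrict hU e hC)

/-- The coefficient of `X` in `A ▷ (B ▷ C)`. -/
theorem sum_N_mul_N_right (A B C X : EdgedTree) (F : Finset TreeClass)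
    (hF : ∀ y, N (treeClass B) (treeClass C) y ≠ 0 → y ∈ F) :
    ∑ y ∈ F, N (treeClass B) (treeClass C) y * N (treeClass A) y (treeClass X) =
      {p : Set X.tree × Set X.tree | IsNested A B C X p.1 p.2}.ncard +
        {p : Set X.tree × Set X.tree | IsSeparated A B C X p.1 p.2}.ncard := by
  classical
  -- The whole tree is excluded because its contraction has no edge; the values in the excluded
  -- cases are arbitrary.
  have hex : ∀ S : Set X.tree, ∃ (Q : EdgedTree) (f : X.tree → Q.tree),
      IsSubtree S → S ≠ Set.univ →
        IsCollapse f ∧ ∀ a b, f a = f b ↔ a = b ∨ (a ∈ S ∧ b ∈ S) := by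
    intro S
    by_cases hS : IsSubtree S
    · by_cases hne : S = Set.univ
      · exact ⟨X, id, fun _ h => absurd hne h⟩
      · obtain ⟨Q, f, h⟩ := hS.exists_isCollapse hne
        exact ⟨Q, f, fun _ _ => h⟩
    · exact ⟨X, id, fun h => absurd h hS⟩
  choose Q f hf using hex
  have hdisj : Disjoint {p : Set X.tree × Set X.tree | IsNested A B C X p.1 p.2}
      {p | IsSeparated A B C X p.1 p.2} := by
    rw [Set.disjoint_left]
    rintro ⟨S, Z⟩ h h'
    obtain ⟨a, ha⟩ := h.inner.nontrivial.nonempty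
    exact Set.disjoint_left.1 h'.disjoint ha (h.subset ha)
  rw [← Set.ncard_union_eq hdisj]
  refine (Finset.sum_congr rfl fun y _ => ?_).trans (sum_mul_ncard_fiber F _ hF
    {S | IsSubtree S ∧ Nonempty (S ≃o A.tree) ∧ S ≠ Set.univ} (fun S => treeClass (Q S))
    (fun S Z => IsNested A B C X S Z ∨ IsSeparated A B C X S Z) ?_ ?_)
  · congr 1
    obtain ⟨Z, rfl⟩ := exists_treeClass_eq y
    refine (N_mk _ _ _).trans (congrArg Set.ncard ?_)
    ext S
    have key (hS : IsSubtree S) (hne : S ≠ Set.univ) :=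
      (isCollapse_toContraction S).nonempty_orderIso (hf S hS hne).1 fun a b =>
        ((hf S hS hne).2 a b).trans (toContraction_eq_iff S a b).symm
    constructor
    · rintro ⟨hS, hA, ⟨e⟩⟩
      have hne : S ≠ Set.univ := by
        rintro rfl
        obtain ⟨p, q, hpq⟩ := exists_pair_ne Z.tree
        refine hpq (e.symm.injective ?_)
        obtain ⟨a, ha⟩ := (isCollapse_toContraction (Set.univ : Set X.tree)).surjective (e.symm p)
        obtain ⟨b, hb⟩ := (isCollapse_toContraction (Set.univ : Set X.tree)).surjective (e.symm q)
        rw [← ha, ← hb, toContraction_eq_iff]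
        simp
      obtain ⟨i⟩ := key hS hne
      exact ⟨⟨hS, hA, hne⟩, Quotient.sound ⟨i.trans e⟩⟩
    · rintro ⟨⟨hS, hA, hne⟩, h⟩
      obtain ⟨e⟩ := Quotient.exact h
      obtain ⟨i⟩ := key hS hne
      exact ⟨hS, hA, ⟨i.symm.trans e⟩⟩
  · rintro S ⟨hS, hA, hne⟩
    exact (N_mk _ _ _).trans (ncard_subtreeSet_collapse hS hA (hf S hS hne).1 (hf S hS hne).2)
  · rintro S Z (h | h)
    · refine ⟨h.inner, h.inner_iso, ?_⟩
      -- With `S` the whole tree, `B` would be a single vertex.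
      rintro rfl
      obtain ⟨g, hg, hgr⟩ := h.middle
      obtain ⟨p, q, hpq⟩ := exists_pair_ne B.tree
      obtain ⟨a, rfl⟩ := hg.surjective p
      obtain ⟨b, rfl⟩ := hg.surjective q
      exact hpq ((hgr a b).2 (Or.inr ⟨trivial, trivial⟩))
    · refine ⟨h.left, h.left_iso, ?_⟩
      rintro rfl
      obtain ⟨a, ha⟩ := h.right.nontrivial.nonempty
      exact Set.disjoint_left.1 h.disjoint trivial ha

end Counting

/-! ### From counts to the bilinear law -/

section Law

variable (K : Type*) [Field K]

theorem insertTree_apply (t t' x : TreeClass) : insertTree K t t' x = (N t t' x : K) := rfl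

theorem insertion_single_single (t t' : TreeClass) (k l : K) :
    insertion K (Finsupp.single t k) (Finsupp.single t' l) = (k * l) • insertTree K t t' := by
  simp [insertion, mul_smul]

theorem insertTree_eq_sum (t t' : TreeClass) :
    insertTree K t t' =
      ∑ y ∈ (finite_support_N t t').toFinset, Finsupp.single y (N t t' y : K) := by
  classical
  ext x
  simp only [insertTree_apply, Finsupp.finsetSum_apply, Finsupp.single_apply,
    Finset.sum_ite_eq', Set.Finite.mem_toFinset, Set.mem_ofPred_eq]
  split_ifs with h
  · rfl
  · rw [not_not.1 h, Nat.cast_zero]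

theorem insertion_insertTree_left (a b c x : TreeClass) :
    insertion K (insertTree K a b) (Finsupp.single c 1) x =
      ((∑ y ∈ (finite_support_N a b).toFinset, N a b y * N y c x : ℕ) : K) := by
  simp [insertTree_eq_sum K a b, insertion_single_single, Finsupp.finsetSum_apply,
    insertTree_apply]

theorem insertion_insertTree_right (a b c x : TreeClass) :
    insertion K (Finsupp.single a 1) (insertTree K b c) x =
      ((∑ y ∈ (finite_support_N b c).toFinset, N b c y * N a y x : ℕ) : K) := by
  simp [insertTree_eq_sum K b c, insertion_single_single, Finsupp.finsetSum_apply,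
    insertTree_apply]

/-- The associator of three trees counts pairs of disjoint subtrees. -/
theorem associator_single_apply (A B C X : EdgedTree) :
    insertion K (insertion K (Finsupp.single (treeClass A) 1) (Finsupp.single (treeClass B) 1))
        (Finsupp.single (treeClass C) 1) (treeClass X) -
      insertion K (Finsupp.single (treeClass A) 1)
        (insertion K (Finsupp.single (treeClass B) 1) (Finsupp.single (treeClass C) 1)) (treeClass X) =
      -({p : Set X.tree × Set X.tree | IsSeparated A B C X p.1 p.2}.ncard : K) := by
  rw [insertion_single_single, insertion_single_single, one_mul, one_smul, one_smul,
    insertion_insertTree_left, insertion_insertTree_right,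
    sum_N_mul_N_left A B C X _ fun y hy => (Set.Finite.mem_toFinset _).2 hy,
    sum_N_mul_N_right A B C X _ fun y hy => (Set.Finite.mem_toFinset _).2 hy]
  push_cast
  ring

/-- Both sides of the identity are trilinear, so basis vectors suffice. -/
theorem isLeftPreLie_of_single {K ι : Type*} [Field K]
    (m : (ι →₀ K) →ₗ[K] (ι →₀ K) →ₗ[K] (ι →₀ K))
    (h : ∀ a b c : ι,
      m (m (.single a 1) (.single b 1)) (.single c 1) -
          m (.single a 1) (m (.single b 1) (.single c 1)) =
        m (m (.single b 1) (.single a 1)) (.single c 1) -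
          m (.single b 1) (m (.single a 1) (.single c 1))) :
    IsLeftPreLie m := by
  have hs : ∀ (a : ι) (k : K), Finsupp.single a k = k • Finsupp.single a (1 : K) := by simp
  intro x y z
  induction x using Finsupp.induction_linear with
  | zero => simp
  | add x x' hx hx' =>
    simp only [map_add, LinearMap.add_apply]
    rw [add_sub_add_comm, hx, hx', add_sub_add_comm]
  | single a k =>
  induction y using Finsupp.induction_linear with
  | zero => simp
  | add y y' hy hy' =>
    simp only [map_add, LinearMap.add_apply]
    rw [add_sub_add_comm, hy, hy', add_sub_add_comm]
  | single b l =>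
  induction z using Finsupp.induction_linear with
  | zero => simp
  | add z z' hz hz' =>
    simp only [map_add]
    rw [add_sub_add_comm, hz, hz', add_sub_add_comm]
  | single c n =>
  rw [hs a k, hs b l, hs c n]
  simp only [map_smul, LinearMap.smul_apply, ← smul_sub, smul_comm l k, h]

end Law

end TreeInsertion

theorem mainTheorem3 (K : Type*) [Field K] :
    TreeInsertion.IsLeftPreLie (TreeInsertion.insertion K) := by
  refine TreeInsertion.isLeftPreLie_of_single _ fun a b c => ?_
  obtain ⟨A, rfl⟩ := TreeInsertion.exists_treeClass_eq a
  obtain ⟨B, rfl⟩ := TreeInsertion.exists_treeClass_eq b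
  obtain ⟨C, rfl⟩ := TreeInsertion.exists_treeClass_eq c
  ext x
  obtain ⟨X, rfl⟩ := TreeInsertion.exists_treeClass_eq x
  rw [Finsupp.sub_apply, Finsupp.sub_apply, TreeInsertion.associator_single_apply,
    TreeInsertion.associator_single_apply, TreeInsertion.ncard_isSeparated_comm]
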